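/- Notation. For $n\ge 0$ let $P_n^{(\alpha,\beta)}(x)=\sum_{l=0}^{n}\frac{(n+\alpha+\beta+1)_l\,(\alpha+l+1)_{n-l}}{l!\,(n-l)!}\left(\frac{x-1}{2}\right)^l$ be the Jacobi polynomials, where $(c)_k$ denotes the rising factorial. Write $\mathbf{x}=(x,y)\in\mathbb{R}^2$, $x=r\cos\theta$, $y=r\sin\theta$, $\rho(\theta)=\begin{pmatrix}\cos\theta&-\sin\theta\\ \sin\theta&\cos\theta\end{pmatrix}$, and for $\mathbf{f}=(f_1,f_2)$ let $\operatorname{curl}\mathbf{f}=\partial_x f_2-\partial_y f_1$. For $m\in\mathbb{Z}$, $j\ge 0$ the standard Zernike polynomials are $$z_{mj}(\mathbf{x})=P_j^{(0,|m|)}(2r^2-1)\,(x+i\,\mathrm{sign}(m)\,y)^{|m|}.$$ For an integer $n\ge 0$ and real $b\ge 0$ put $$\mathfrak{r}_n^{(b)}=10n^2+n(13b+19)+4(b+1)(b+2),$$ $$\mathbf{v}_n^{(b)}(t)=\begin{pmatrix}(b+1)(1-t)P_n^{(1,b+1)}(2t-1)-2t(n+1)P_n^{(0,b+2)}(2t-1)\\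 (b+1)P_n^{(1,b+1)}(2t-1)\end{pmatrix},$$ $$\mathbf{q}_n^{(b),1}(t)=\frac{2n+b+1}{(n+1)\mathfrak{r}_n^{(b)}}\left[(2n+b+2)(2n+b+3)P_n^{(1,b)}(2t-1)\begin{pmatrix}1-t\\1\end{pmatrix}-(n+b+2)\mathbf{v}_n^{(b)}(t)\right],$$ $$\mathbf{q}_n^{(b),2}(t)=-\frac{1}{n}\mathbf{v}_{n-1}^{(b)}(t)-\mathbf{q}_n^{(b),1}(t)\quad(n\ge 1).$$ Let $N(x,y)=\begin{pmatrix}1-y^2&xy\\xy&1-x^2\end{pmatrix}$ and, for $\nu\in\{1,2\}$, let $\mathbf{n}_{mj}^{\nu}=N\,\mathbf{v}_{mj}^{N,\nu}$, where for $j\ge 1$ $$\mathbf{v}_{0j}^{N,1}(\mathbf{x})=P_{j-1}^{(0,1)}(2r^2-1)\begin{pmatrix}x\\y\end{pmatrix},\qquad \mathbf{v}_{0j}^{N,2}(\mathbf{x})=P_{j-1}^{(1,1)}(2r^2-1)\begin{pmatrix}-y\\x\end{pmatrix},$$ and for $m\ne 0$ (with $j\ge 0$ if $\nu=1$ and $j\ge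 1$ if $\nu=2$) $$\mathbf{v}_{mj}^{N,\nu}(\mathbf{x})=r^{|m|-1}e^{im\theta}\rho(\theta)\begin{pmatrix}1&0\\0&i\,\mathrm{sign}(m)\end{pmatrix}\mathbf{q}_j^{(|m|-1),\nu}(r^2).$$ Finally set $$\mathbf{n}_{0j}^{+}=2\mathbf{n}_{0j}^{1},\quad \mathbf{n}_{0j}^{-}=2\mathbf{n}_{0j}^{2}\ (j\ge 1),\qquad \mathbf{n}_{m0}^{-}=2\mathbf{n}_{m0}^{1}\ (m\ne 0),\qquad \mathbf{n}_{mj}^{\pm}=\mathbf{n}_{mj}^{1}\pm\mathbf{n}_{mj}^{2}\ (m\ne 0,\ j\ge 1).$$ Theorem 7. The vector fields $\mathbf{n}_{mj}^{\pm}$ are differentiable on $\mathbb{R}^2$, and the following identities hold at every point of $\mathbb{R}^2$ (in particular on the unit disk): $$\operatorname{curl}\mathbf{n}_{mj}^{+}=0\qquad (m\in\mathbb{Z},\ j\ge 1),$$ $$\operatorname{curl}\mathbf{n}_{0j}^{-}=-4j\,z_{0j}\qquad (j\ge 1),$$ $$\operatorname{curl}\mathbf{n}_{mj}^{-}=-\frac{4(2j+|m|)(2j+|m|+1)(2j+|m|+2)}{\mathfrak{r}_j^{(|m|-1)}}\;i\,\mathrm{sign}(m)\,z_{mj}\qquad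 (m\ne 0,\ j\ge 0).$$ -/

import Mathlib

noncomputable section

namespace DiskVectorOP

open Matrix

/-- The Jacobi polynomial `P_n^{(α,β)}`, given by its expansion about `1`:
`∑ₗ (n+α+β+1)ₗ (α+l+1)ₙ₋ₗ / (l! (n-l)!) ((x-1)/2)^l`, with `(c)ₖ` the rising factorial. -/
def jacobiP (n : ℕ) (α β : ℝ) : Polynomial ℝ :=
  ∑ l ∈ Finset.range (n + 1),
    Polynomial.C
        ((ascPochhammer ℝ l).eval (n + α + β + 1) * (ascPochhammer ℝ (n - l)).eval (α + l + 1)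
          / (l.factorial * (n - l).factorial)) *
      (Polynomial.C (1 / 2) * (Polynomial.X - 1)) ^ l

/-- The polar radius `r` of the point `p = (x, y)`. -/
def radius (p : ℝ × ℝ) : ℝ := √(p.1 ^ 2 + p.2 ^ 2)

/-- The polar angle `θ` of the point `p = (x, y)` (with value `0` at the origin). -/
def angle (p : ℝ × ℝ) : ℝ := Complex.arg ⟨p.1, p.2⟩

/-- The rotation matrix `ρ(φ)`. -/
def rot (φ : ℝ) : Matrix (Fin 2) (Fin 2) ℂ :=
  !![(Real.cos φ : ℂ), -(Real.sin φ : ℂ); (Real.sin φ : ℂ), (Real.cos φ : ℂ)]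

/-- The harmonic polynomial `y_m(x, y) = (x + i sign(m) y)^{|m|} = r^{|m|} e^{imθ}`. -/
def harmonicY (m : ℤ) (p : ℝ × ℝ) : ℂ :=
  ((p.1 : ℂ) + (m.sign : ℂ) * Complex.I * (p.2 : ℂ)) ^ m.natAbs

/-- The generalised Zernike polynomial `z_{mj}^{(lam)} = P_j^{(lam,|m|)}(2r² - 1) y_m`. -/
def zernikeGen (lam : ℝ) (m : ℤ) (j : ℕ) (p : ℝ × ℝ) : ℂ :=
  (((jacobiP j lam (m.natAbs : ℝ)).eval (2 * radius p ^ 2 - 1) : ℝ) : ℂ) * harmonicY m p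

/-- The standard Zernike polynomial `z_{mj}`. -/
def zernike (m : ℤ) (j : ℕ) (p : ℝ × ℝ) : ℂ := zernikeGen 0 m j p

/-- The constant `𝔯_n^{(b)}`. -/
def frakR (n : ℕ) (b : ℝ) : ℝ :=
  10 * (n : ℝ) ^ 2 + n * (13 * b + 19) + 4 * (b + 1) * (b + 2)

/-- The univariate vector polynomial `𝐯_n^{(b)}(t)`. -/
def vecV (n : ℕ) (b t : ℝ) : Fin 2 → ℝ :=
  ![(b + 1) * (1 - t) * (jacobiP n 1 (b + 1)).eval (2 * t - 1)
      - 2 * t * (n + 1) * (jacobiP n 0 (b + 2)).eval (2 * t - 1),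
    (b + 1) * (jacobiP n 1 (b + 1)).eval (2 * t - 1)]

/-- The univariate vector polynomial `𝐪_n^{(b),1}(t)`. -/
def vecQ1 (n : ℕ) (b t : ℝ) : Fin 2 → ℝ :=
  ((2 * n + b + 1) / ((n + 1) * frakR n b)) •
    (((2 * n + b + 2) * (2 * n + b + 3) * (jacobiP n 1 b).eval (2 * t - 1)) • ![1 - t, 1]
      - (n + b + 2) • vecV n b t)

/-- The univariate vector polynomial `𝐪_n^{(b),2}(t) = -𝐯_{n-1}^{(b)}(t)/n - 𝐪_n^{(b),1}(t)` for
`n ≥ 1`, with the convention `𝐪_0^{(b),2} = 0`. -/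
def vecQ2 : ℕ → ℝ → ℝ → Fin 2 → ℝ
  | 0, _, _ => 0
  | n + 1, b, t => -((1 / ((n : ℝ) + 1)) • vecV n b t) - vecQ1 (n + 1) b t

/-- For `m ≠ 0`, the map `𝒫_m` from univariate vector polynomials to vector fields of mode `m`:
`𝒫_m 𝐟 = r^{|m|-1} e^{imθ} ρ(θ) diag(1, i sign m) 𝐟(r²)`. -/
def modeMap (m : ℤ) (f : ℝ → Fin 2 → ℝ) (p : ℝ × ℝ) : Fin 2 → ℂ :=
  ((radius p : ℂ) ^ (m.natAbs - 1) * Complex.exp (Complex.I * m * angle p)) •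
    (rot (angle p) *ᵥ
      (Matrix.diagonal ![1, Complex.I * (m.sign : ℂ)] *ᵥ fun k => ((f (radius p ^ 2) k : ℝ) : ℂ)))

/-- The matrix weight `N(x, y)`, normal at the boundary of the unit disk. -/
def weightN (p : ℝ × ℝ) : Matrix (Fin 2) (Fin 2) ℂ :=
  !![1 - (p.2 : ℂ) ^ 2, (p.1 : ℂ) * (p.2 : ℂ); (p.1 : ℂ) * (p.2 : ℂ), 1 - (p.1 : ℂ) ^ 2]

/-- `𝐯_{mj}^{N,1}`: for `m = 0`, `j ≥ 1` it is `P_{j-1}^{(0,1)}(2r² - 1) r 𝐞_r`, where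
`r 𝐞_r = (x, y)`; for `m ≠ 0` it is `𝒫_m 𝐪_j^{(|m|-1),1}`. The case `m = j = 0` is unused. -/
def vecN1 (m : ℤ) (j : ℕ) (p : ℝ × ℝ) : Fin 2 → ℂ :=
  if m = 0 then
    (((jacobiP (j - 1) 0 1).eval (2 * radius p ^ 2 - 1) : ℝ) : ℂ) • ![(p.1 : ℂ), (p.2 : ℂ)]
  else modeMap m (vecQ1 j ((m.natAbs : ℝ) - 1)) p

/-- `𝐯_{mj}^{N,2}`: for `m = 0`, `j ≥ 1` it is `P_{j-1}^{(1,1)}(2r² - 1) r 𝐞_θ`, where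
`r 𝐞_θ = (-y, x)`; for `m ≠ 0` it is `𝒫_m 𝐪_j^{(|m|-1),2}`. The case `m = j = 0` is unused. -/
def vecN2 (m : ℤ) (j : ℕ) (p : ℝ × ℝ) : Fin 2 → ℂ :=
  if m = 0 then
    (((jacobiP (j - 1) 1 1).eval (2 * radius p ^ 2 - 1) : ℝ) : ℂ) • ![-(p.2 : ℂ), (p.1 : ℂ)]
  else modeMap m (vecQ2 j ((m.natAbs : ℝ) - 1)) p

/-- `𝐧_{mj}^1 = N 𝐯_{mj}^{N,1}`. -/
def n1 (m : ℤ) (j : ℕ) (p : ℝ × ℝ) : Fin 2 → ℂ := weightN p *ᵥ vecN1 m j p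

/-- `𝐧_{mj}^2 = N 𝐯_{mj}^{N,2}`. -/
def n2 (m : ℤ) (j : ℕ) (p : ℝ × ℝ) : Fin 2 → ℂ := weightN p *ᵥ vecN2 m j p

/-- `𝐧_{mj}^+`, meaningful for `j ≥ 1`. -/
def nPlus (m : ℤ) (j : ℕ) (p : ℝ × ℝ) : Fin 2 → ℂ :=
  if m = 0 then (2 : ℂ) • n1 0 j p else n1 m j p + n2 m j p

/-- `𝐧_{mj}^-`, meaningful for `m ≠ 0` or `j ≥ 1`. -/
def nMinus (m : ℤ) (j : ℕ) (p : ℝ × ℝ) : Fin 2 → ℂ :=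
  if m = 0 then (2 : ℂ) • n2 0 j p
  else if j = 0 then (2 : ℂ) • n1 m 0 p
  else n1 m j p - n2 m j p

/-- The planar curl `∂_x f₂ - ∂_y f₁` of a vector field `f = (f₁, f₂)`. -/
def curl (f : ℝ × ℝ → Fin 2 → ℂ) (p : ℝ × ℝ) : ℂ :=
  deriv (fun x : ℝ => f (x, p.2) 1) p.1 - deriv (fun y : ℝ => f (p.1, y) 0) p.2

end DiskVectorOP

end

/-!
Let `m ≠ 0`, `c = i sign(m)`, `w = x + c y`. Multiplication by `N` removes from a field `v` the
part `(x v₂ - y v₁) (-y, x)`, and passing from polar to Cartesian coordinates, a field of mode `m`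
with profile `f(t) = (A(t) + t G(t), A(t))` becomes, after multiplication by `N`,
`A(r²) w^(|m|-1) (1, c) + G(r²) w^|m| (x, y) - c A(r²) w^|m| (-y, x)`. By the product rules for
radial functions and for powers of `w` (here `c² = -1` is used), its curl is
`(2 ((1 - t) A)' - |m| (A + G))(r²) c w^|m|`, so only one-variable derivatives remain.

The required derivative relations for Jacobi polynomials in `t` are contiguity relations between
their Taylor coefficients at `t = 1`. The key one, `((1 - t) P_n^(1,β))' = -(n + 1) P_n^(0,β+1)`
with argument `2t - 1`, shows that the fields with profile `𝐯_n` are curl free. Hence `𝐧⁺`, whose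
profile is a multiple of `𝐯_{j-1}`, is curl free, and `curl 𝐧⁻ = curl (2 𝐧¹ - 𝐧⁺) = 2 curl 𝐧¹`
comes only from the `P_j^(1,|m|-1)` term of `𝐪_j^1`. For `m = 0` the product rules
apply directly to the fields `φ(r²) (x, y)` and `φ(r²) (-y, x)`.
-/

noncomputable section

namespace DiskVectorOP

open Matrix Polynomial

/-- The coefficient of `((x - 1) / 2) ^ l` in the Jacobi polynomial `P_n^{(α,β)}(x)`. Writing
`1 / (l! (n - l)!)` as a binomial coefficient over `n!` makes it vanish for `n < l`. -/
def jacobiCoeff (n : ℕ) (α β : ℝ) (l : ℕ) : ℝ :=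
  n.choose l / n.factorial *
    ((ascPochhammer ℝ l).eval (n + α + β + 1) * (ascPochhammer ℝ (n - l)).eval (α + l + 1))

lemma ascPochhammer_succ_eval_left {R : Type*} [CommSemiring R] (k : ℕ) (x : R) :
    (ascPochhammer R (k + 1)).eval x = x * (ascPochhammer R k).eval (x + 1) := by
  simp [ascPochhammer_succ_left, eval_comp]

lemma jacobiCoeff_add_one_left (n : ℕ) (α β : ℝ) (l : ℕ) :
    (l + α + 1) * jacobiCoeff n (α + 1) β l = (n + α + 1) * jacobiCoeff n α (β + 1) l := by
  rcases lt_or_ge n l with hnl | hln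
  · simp [jacobiCoeff, Nat.choose_eq_zero_of_lt hnl]
  · have h := (ascPochhammer_succ_eval_left (n - l) (α + l + 1)).symm.trans
      (ascPochhammer_succ_eval _ _)
    rw [Nat.cast_sub hln] at h
    rw [jacobiCoeff, jacobiCoeff, show (n + (α + 1) + β + 1 : ℝ) = n + α + (β + 1) + 1 by ring,
      show α + 1 + (l : ℝ) + 1 = α + l + 1 + 1 by ring]
    linear_combination (n.choose l / n.factorial
      * (ascPochhammer ℝ l).eval (n + α + (β + 1) + 1 : ℝ)) * h

lemma cast_choose_succ_mul {R : Type*} [Ring R] (n l : ℕ) :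
    (n.choose (l + 1) * (l + 1) : R) = n.choose l * (n - l) := by
  rcases lt_or_ge n l with hnl | hln
  · simp [Nat.choose_eq_zero_of_lt hnl, Nat.choose_eq_zero_of_lt (Nat.lt_succ_of_lt hnl)]
  · rw [← Nat.cast_sub hln]
    simpa only [Nat.cast_mul, Nat.cast_succ] using
      congrArg (Nat.cast (R := R)) (Nat.choose_succ_right_eq n l)

lemma jacobiCoeff_succ_degree_zero (n : ℕ) (α β : ℝ) :
    (n + 1) * jacobiCoeff (n + 1) α β 0 = (α + 1) * jacobiCoeff n (α + 1) (β + 1) 0 := by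
  simp only [jacobiCoeff, Nat.choose_zero_right, Nat.sub_zero, ascPochhammer_succ_eval_left,
    Nat.factorial_succ, ascPochhammer_zero, eval_one]
  push_cast
  rw [add_zero, add_zero]
  field_simp

lemma jacobiCoeff_succ_degree_succ (n : ℕ) (α β : ℝ) (l : ℕ) :
    (n + 1) * jacobiCoeff (n + 1) α β (l + 1)
      = (l + α + 2) * jacobiCoeff n (α + 1) (β + 1) (l + 1)
        + (l + α + β + 2) * jacobiCoeff n (α + 1) (β + 1) l := by
  have hpoch : (n.choose (l + 1) : ℝ)
      * ((l + α + 2) * (ascPochhammer ℝ (n - (l + 1))).eval (l + α + 2 + 1))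
      = n.choose (l + 1) * (ascPochhammer ℝ (n - l)).eval (l + α + 2) := by
    rcases lt_or_ge l n with hln | hnl
    · rw [← ascPochhammer_succ_eval_left, ← Nat.sub_sub,
        Nat.sub_add_cancel (Nat.sub_pos_of_lt hln)]
    · simp [Nat.choose_eq_zero_of_lt (Nat.lt_succ_of_le hnl)]
  have hchoose := cast_choose_succ_mul (R := ℝ) n l
  simp only [jacobiCoeff, Nat.add_sub_add_right, Nat.factorial_succ, Nat.choose_succ_succ']
  push_cast
  rw [show (n + 1 + α + β + 1 : ℝ) = n + α + β + 2 by ring,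
    show (n + (α + 1) + (β + 1) + 1 : ℝ) = n + α + β + 2 + 1 by ring,
    show α + (l + 1 : ℝ) + 1 = l + α + 2 by ring,
    show α + 1 + (l + 1 : ℝ) + 1 = l + α + 2 + 1 by ring,
    show α + 1 + (l : ℝ) + 1 = l + α + 2 by ring,
    ascPochhammer_succ_eval_left l (n + α + β + 2), ascPochhammer_succ_eval]
  generalize (ascPochhammer ℝ l).eval (n + α + β + 2 + 1 : ℝ) = P at *
  generalize (ascPochhammer ℝ (n - l)).eval (l + α + 2 : ℝ) = Q at *
  generalize (ascPochhammer ℝ (n - (l + 1))).eval (l + α + 2 + 1 : ℝ) = Q' at *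
  field_simp
  linear_combination (-P * (n + α + β + 2 + 1 + l)) * hpoch - P * Q * hchoose

/-- The Jacobi polynomial shifted to `[0, 1]`, that is `P_n^{(α,β)}(2t - 1)`. -/
def shiftedJacobi (n : ℕ) (α β : ℝ) : ℝ[X] := (jacobiP n α β).comp (2 * X - 1)

lemma eval_shiftedJacobi (n : ℕ) (α β t : ℝ) :
    (shiftedJacobi n α β).eval t = (jacobiP n α β).eval (2 * t - 1) := by
  simp [shiftedJacobi, eval_comp]

lemma taylor_one_shiftedJacobi (n : ℕ) (α β : ℝ) :
    taylor 1 (shiftedJacobi n α β)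
      = ∑ l ∈ Finset.range (n + 1), monomial l (jacobiCoeff n α β l) := by
  refine Polynomial.funext fun t => ?_
  rw [taylor_eval, eval_shiftedJacobi, jacobiP, eval_finsetSum, eval_finsetSum]
  refine Finset.sum_congr rfl fun l hl => ?_
  have hln : l ≤ n := Finset.mem_range_succ_iff.1 hl
  rw [eval_monomial, jacobiCoeff, Nat.cast_choose ℝ hln]
  simp only [eval_mul, eval_C, eval_pow, eval_sub, eval_X, eval_one]
  field_simp
  ring

lemma coeff_taylor_one_shiftedJacobi (n : ℕ) (α β : ℝ) (l : ℕ) :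
    (taylor 1 (shiftedJacobi n α β)).coeff l = jacobiCoeff n α β l := by
  rw [taylor_one_shiftedJacobi]
  simp only [finsetSum_coeff, coeff_monomial, Finset.sum_ite_eq', Finset.mem_range,
    ite_eq_left_iff, not_lt]
  intro h
  simp [jacobiCoeff, Nat.choose_eq_zero_of_lt h]

lemma taylor_derivative {R : Type*} [CommSemiring R] (p : R[X]) (r : R) :
    taylor r (derivative p) = derivative (taylor r p) := by
  simp [taylor_apply, derivative_comp]

lemma coeff_X_mul_derivative {R : Type*} [Semiring R] (p : R[X]) (l : ℕ) :
    (X * derivative p).coeff l = l * p.coeff l := by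
  rcases l with _ | l
  · simp
  · rw [coeff_X_mul, coeff_derivative, ← Nat.cast_succ, Nat.cast_comm]

lemma one_sub_X_mul_derivative_shiftedJacobi (n : ℕ) (α β : ℝ) :
    (1 - X) * derivative (shiftedJacobi n (α + 1) β)
      = C (α + 1) * shiftedJacobi n (α + 1) β - C (n + α + 1) * shiftedJacobi n α (β + 1) := by
  apply taylor_injective 1
  have hX : taylor (1 : ℝ) (1 - X) = -X := by simp
  rw [map_sub, taylor_mul, taylor_mul, taylor_mul, hX, taylor_C, taylor_C, taylor_derivative]
  ext l
  rw [neg_mul, coeff_neg, coeff_X_mul_derivative, coeff_sub, coeff_C_mul, coeff_C_mul]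
  simp only [coeff_taylor_one_shiftedJacobi]
  linear_combination -jacobiCoeff_add_one_left n α β l

lemma X_mul_one_sub_X_mul_derivative_shiftedJacobi (n : ℕ) (α β : ℝ) :
    X * (1 - X) * derivative (shiftedJacobi n (α + 1) (β + 1))
      = (C (α + β + 2) * X - C (β + 1)) * shiftedJacobi n (α + 1) (β + 1)
        - C (n + 1 : ℝ) * shiftedJacobi (n + 1) α β := by
  apply taylor_injective 1
  set p := taylor 1 (shiftedJacobi n (α + 1) (β + 1)) with hp
  set q := taylor 1 (shiftedJacobi (n + 1) α β) with hq
  suffices X * derivative p + X * (X * derivative p) + C (α + 1) * p + C (α + β + 2) * (X * p)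
      = C (n + 1 : ℝ) * q by
    simp only [map_sub, taylor_mul, taylor_C, taylor_X, taylor_one, taylor_derivative, ← hp, ← hq]
    simp only [map_add, map_one, map_ofNat] at this ⊢
    linear_combination -this
  ext l
  rcases l with _ | l
  · simp [hp, hq, coeff_taylor_one_shiftedJacobi, -taylor_coeff_zero,
      jacobiCoeff_succ_degree_zero]
  · simp only [coeff_add, coeff_C_mul, coeff_X_mul _ l, coeff_X_mul_derivative _ l]
    rw [← coeff_X_mul (derivative p), coeff_X_mul_derivative]
    simp only [hp, hq, coeff_taylor_one_shiftedJacobi]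
    rw [jacobiCoeff_succ_degree_succ]
    push_cast
    ring

lemma derivative_one_sub_X_mul_shiftedJacobi (n : ℕ) (β : ℝ) :
    derivative ((1 - X) * shiftedJacobi n 1 β)
      = -(C (n + 1 : ℝ) * shiftedJacobi n 0 (β + 1)) := by
  have h := one_sub_X_mul_derivative_shiftedJacobi n 0 β
  simp only [zero_add, add_zero, map_one, one_mul] at h
  simp only [derivative_mul, derivative_sub, derivative_one, derivative_X]
  linear_combination h

lemma derivative_X_mul_one_sub_X_mul_shiftedJacobi (n : ℕ) :
    derivative (X * ((1 - X) * shiftedJacobi n 1 1))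
      = -(C (n + 1 : ℝ) * shiftedJacobi (n + 1) 0 0) := by
  have h := X_mul_one_sub_X_mul_derivative_shiftedJacobi n 0 0
  simp only [zero_add, map_one, map_ofNat] at h
  simp only [derivative_mul, derivative_sub, derivative_one, derivative_X]
  linear_combination h

/-- A vector field `f` on the plane is differentiable with curl `κ`. -/
def HasCurl (f : ℝ × ℝ → Fin 2 → ℂ) (κ : ℝ × ℝ → ℂ) : Prop :=
  Differentiable ℝ f ∧ ∀ p, curl f p = κ p

/-- The variable `x + c y`; for `c = ± i` it is the complex coordinate or its conjugate. -/
def planarVar (c : ℂ) (p : ℝ × ℝ) : ℂ := p.1 + c * p.2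

lemma radius_sq (p : ℝ × ℝ) : radius p ^ 2 = p.1 ^ 2 + p.2 ^ 2 :=
  Real.sq_sqrt (by positivity)

lemma hasDerivAt_ofReal (x : ℝ) : HasDerivAt (fun x : ℝ => (x : ℂ)) 1 x :=
  (hasDerivAt_id x).ofReal_comp

lemma differentiable_ofReal_fst : Differentiable ℝ fun p : ℝ × ℝ => (p.1 : ℂ) :=
  Complex.ofRealCLM.differentiable.comp differentiable_fst

lemma differentiable_ofReal_snd : Differentiable ℝ fun p : ℝ × ℝ => (p.2 : ℂ) :=
  Complex.ofRealCLM.differentiable.comp differentiable_snd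

lemma differentiable_planarVar (c : ℂ) : Differentiable ℝ (planarVar c) :=
  differentiable_ofReal_fst.add (differentiable_ofReal_snd.const_mul c)

namespace HasCurl

variable {f g : ℝ × ℝ → Fin 2 → ℂ} {κ μ : ℝ × ℝ → ℂ}

lemma congr_curl (hf : HasCurl f κ) (h : ∀ p, κ p = μ p) : HasCurl f μ :=
  ⟨hf.1, fun p => (hf.2 p).trans (h p)⟩

lemma differentiableAt_fst (hf : HasCurl f κ) (i : Fin 2) (p : ℝ × ℝ) :
    DifferentiableAt ℝ (fun x : ℝ => f (x, p.2) i) p.1 :=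
  (differentiable_pi.1 hf.1 i).comp (by fun_prop : Differentiable ℝ fun x : ℝ => (x, p.2)) _

lemma differentiableAt_snd (hf : HasCurl f κ) (i : Fin 2) (p : ℝ × ℝ) :
    DifferentiableAt ℝ (fun y : ℝ => f (p.1, y) i) p.2 :=
  (differentiable_pi.1 hf.1 i).comp (by fun_prop : Differentiable ℝ fun y : ℝ => (p.1, y)) _

lemma add (hf : HasCurl f κ) (hg : HasCurl g μ) : HasCurl (f + g) (fun p => κ p + μ p) := by
  refine ⟨hf.1.add hg.1, fun p => ?_⟩
  simp only [← hf.2 p, ← hg.2 p, curl, Pi.add_apply]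
  rw [deriv_fun_add (hf.differentiableAt_fst 1 p) (hg.differentiableAt_fst 1 p),
    deriv_fun_add (hf.differentiableAt_snd 0 p) (hg.differentiableAt_snd 0 p)]
  ring

lemma smul {φ φx φy : ℝ × ℝ → ℂ} (hf : HasCurl f κ) (hφ : Differentiable ℝ φ)
    (hφx : ∀ p : ℝ × ℝ, HasDerivAt (fun x => φ (x, p.2)) (φx p) p.1)
    (hφy : ∀ p : ℝ × ℝ, HasDerivAt (fun y => φ (p.1, y)) (φy p) p.2) :
    HasCurl (fun p => φ p • f p) (fun p => φ p * κ p + (φx p * f p 1 - φy p * f p 0)) := by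
  refine ⟨hφ.smul hf.1, fun p => ?_⟩
  simp only [← hf.2 p, curl, Pi.smul_apply, smul_eq_mul]
  rw [((hφx p).fun_mul (hf.differentiableAt_fst 1 p).hasDerivAt).deriv,
    ((hφy p).fun_mul (hf.differentiableAt_snd 0 p).hasDerivAt).deriv]
  ring

lemma const_smul (hf : HasCurl f κ) (c : ℂ) : HasCurl (c • f) (fun p => c * κ p) :=
  (hf.smul (differentiable_const c) (fun _ => hasDerivAt_const _ _)
    fun _ => hasDerivAt_const _ _).congr_curl fun p => by ring

lemma sub (hf : HasCurl f κ) (hg : HasCurl g μ) : HasCurl (f - g) (fun p => κ p - μ p) := by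
  rw [sub_eq_add_neg, ← neg_one_smul ℂ g]
  exact (hf.add (hg.const_smul (-1))).congr_curl fun p => by ring

lemma radial_smul (hf : HasCurl f κ) {φ : ℝ → ℝ} (hφ : Differentiable ℝ φ) :
    HasCurl (fun p => (φ (radius p ^ 2) : ℂ) • f p)
      (fun p => φ (radius p ^ 2) * κ p
        + 2 * deriv φ (radius p ^ 2) * (p.1 * f p 1 - p.2 * f p 0)) := by
  simp only [radius_sq]
  have hφx (x y : ℝ) : HasDerivAt (fun x : ℝ => (φ (x ^ 2 + y ^ 2) : ℂ))
      ((deriv φ (x ^ 2 + y ^ 2) * (2 * x) : ℝ) : ℂ) x := by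
    simpa using ((hφ _).hasDerivAt.comp x ((hasDerivAt_pow 2 x).add_const (y ^ 2))).ofReal_comp
  have hφy (x y : ℝ) : HasDerivAt (fun y : ℝ => (φ (x ^ 2 + y ^ 2) : ℂ))
      ((deriv φ (x ^ 2 + y ^ 2) * (2 * y) : ℝ) : ℂ) y := by
    simpa only [add_comm] using hφx y x
  have hdiff : Differentiable ℝ fun p : ℝ × ℝ => (φ (p.1 ^ 2 + p.2 ^ 2) : ℂ) :=
    Complex.ofRealCLM.differentiable.comp (hφ.comp (by fun_prop))
  refine (hf.smul hdiff (fun p => hφx p.1 p.2) fun p => hφy p.1 p.2).congr_curl fun p => ?_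
  push_cast
  ring

lemma planarVar_pow_smul (hf : HasCurl f κ) (c : ℂ) (k : ℕ) :
    HasCurl (fun p => planarVar c p ^ k • f p)
      (fun p => planarVar c p ^ k * κ p
        + k * planarVar c p ^ (k - 1) * (f p 1 - c * f p 0)) := by
  have hx (p : ℝ × ℝ) : HasDerivAt (fun x : ℝ => planarVar c (x, p.2)) 1 p.1 :=
    (hasDerivAt_ofReal p.1).add_const (c * p.2)
  have hy (p : ℝ × ℝ) : HasDerivAt (fun y : ℝ => planarVar c (p.1, y)) (c * 1) p.2 :=
    ((hasDerivAt_ofReal p.2).const_mul c).const_add (p.1 : ℂ)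
  exact (hf.smul ((differentiable_planarVar c).fun_pow k) (fun p => (hx p).fun_pow k)
    fun p => (hy p).fun_pow k).congr_curl fun p => by ring

end HasCurl

lemma hasCurl_const (v : Fin 2 → ℂ) : HasCurl (fun _ => v) 0 :=
  ⟨differentiable_const v, fun p => by simp [curl]⟩

lemma hasCurl_position : HasCurl (fun p => ![(p.1 : ℂ), (p.2 : ℂ)]) 0 := by
  refine ⟨differentiable_pi.2 fun i => ?_, fun p => by simp [curl]⟩
  fin_cases i
  exacts [differentiable_ofReal_fst, differentiable_ofReal_snd]

lemma hasCurl_rotation : HasCurl (fun p => ![-(p.2 : ℂ), (p.1 : ℂ)]) 2 := by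
  refine ⟨differentiable_pi.2 fun i => ?_, fun p => ?_⟩
  · fin_cases i
    exacts [differentiable_ofReal_snd.neg, differentiable_ofReal_fst]
  · simp only [curl, cons_val_zero, cons_val_one]
    rw [(hasDerivAt_ofReal p.1).deriv, (hasDerivAt_ofReal p.2).fun_neg.deriv]
    norm_num

lemma weightN_mulVec (p : ℝ × ℝ) (v : Fin 2 → ℂ) :
    weightN p *ᵥ v = v - (p.1 * v 1 - p.2 * v 0) • ![-(p.2 : ℂ), (p.1 : ℂ)] := by
  ext i
  fin_cases i <;>
  · simp only [weightN, mulVec_fin_two, of_apply, cons_val', cons_val_zero, cons_val_one,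
      cons_val_fin_one, Fin.zero_eta, Fin.mk_one, Pi.sub_apply, Pi.smul_apply, smul_eq_mul]
    ring

lemma radius_eq_norm (p : ℝ × ℝ) : radius p = ‖(⟨p.1, p.2⟩ : ℂ)‖ := by
  rw [Complex.norm_eq_sqrt_sq_add_sq, radius]

lemma radius_mul_cos_angle (p : ℝ × ℝ) : radius p * Real.cos (angle p) = p.1 := by
  rw [radius_eq_norm, angle, Complex.norm_mul_cos_arg]

lemma radius_mul_sin_angle (p : ℝ × ℝ) : radius p * Real.sin (angle p) = p.2 := by
  rw [radius_eq_norm, angle, Complex.norm_mul_sin_arg]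

/-- The unit `i sign(m)`, a square root of `-1` for `m ≠ 0`. -/
def modeUnit (m : ℤ) : ℂ := Complex.I * m.sign

lemma modeUnit_sq {m : ℤ} (hm : m ≠ 0) : modeUnit m ^ 2 = -1 := by
  rcases hm.lt_or_gt with h | h
  · simp [modeUnit, Int.sign_eq_neg_one_of_neg h]
  · simp [modeUnit, Int.sign_eq_one_of_pos h]

lemma exp_I_mul_int_mul (m : ℤ) (φ : ℝ) :
    Complex.exp (Complex.I * m * φ)
      = ((Real.cos φ : ℂ) + modeUnit m * Real.sin φ) ^ m.natAbs := by
  have hmul : (Complex.I * m * φ : ℂ) = m.natAbs * ((m.sign * φ : ℂ) * Complex.I) := by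
    have h : ((m.sign * (m.natAbs : ℤ) : ℤ) : ℂ) = m := congrArg _ (Int.sign_mul_natAbs m)
    rw [Int.cast_mul, Int.cast_natCast] at h
    linear_combination (-Complex.I * φ) * h
  rw [hmul, Complex.exp_nat_mul, Complex.exp_mul_I]
  rcases lt_trichotomy m 0 with h | rfl | h
  · simp [modeUnit, Int.sign_eq_neg_one_of_neg h, mul_comm]
  · simp
  · simp [modeUnit, Int.sign_eq_one_of_pos h, mul_comm]

lemma harmonicY_eq_planarVar_pow (m : ℤ) (p : ℝ × ℝ) :
    harmonicY m p = planarVar (modeUnit m) p ^ m.natAbs := by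
  rw [harmonicY, planarVar, modeUnit, mul_comm Complex.I]

lemma modeMap_eq {m : ℤ} (hm : m ≠ 0) {f : ℝ → Fin 2 → ℝ} {A G : ℝ → ℝ}
    (hf : ∀ t, f t = ![A t + t * G t, A t]) (p : ℝ × ℝ) :
    modeMap m f p
      = (A (radius p ^ 2) : ℂ) • planarVar (modeUnit m) p ^ (m.natAbs - 1)
            • ![1, modeUnit m]
        + (G (radius p ^ 2) : ℂ) • planarVar (modeUnit m) p ^ m.natAbs
            • ![(p.1 : ℂ), (p.2 : ℂ)] := by
  have hc := modeUnit_sq hm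
  obtain ⟨b, hb⟩ := Nat.exists_eq_succ_of_ne_zero (Int.natAbs_ne_zero.2 hm)
  have hx : (radius p * Real.cos (angle p) : ℂ) = p.1 := mod_cast radius_mul_cos_angle p
  have hy : (radius p * Real.sin (angle p) : ℂ) = p.2 := mod_cast radius_mul_sin_angle p
  have hcs : (Real.cos (angle p) : ℂ) ^ 2 + (Real.sin (angle p) : ℂ) ^ 2 = 1 :=
    mod_cast Real.cos_sq_add_sin_sq (angle p)
  have hunit : Complex.I * (m.sign : ℂ) = modeUnit m := rfl
  simp only [modeMap, hunit, rot, hf, exp_I_mul_int_mul, hb, planarVar, Nat.succ_eq_add_one,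
    Nat.add_sub_cancel, ← hx, ← hy]
  generalize modeUnit m = c at *
  generalize (Real.cos (angle p) : ℂ) = u at *
  generalize (Real.sin (angle p) : ℂ) = v at *
  rw [show radius p * u + c * (radius p * v) = radius p * (u + c * v) by ring, mul_pow, mul_pow,
    pow_succ (u + c * v)]
  generalize (u + c * v) ^ b = e
  ext i
  fin_cases i <;>
    simp only [mulVec_fin_two, diagonal_apply, of_apply, cons_val', cons_val_zero, cons_val_one,
      cons_val_fin_one, Fin.zero_eta, Fin.mk_one, Pi.add_apply, Pi.smul_apply, smul_eq_mul,
      if_true, zero_ne_one, one_ne_zero, if_false, zero_mul, Complex.ofReal_add,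
      Complex.ofReal_mul, Complex.ofReal_pow]
  · linear_combination (radius p ^ b * e * A (radius p ^ 2)) * (hcs - v ^ 2 * hc)
  · linear_combination (radius p ^ b * e * A (radius p ^ 2)) * (c * hcs + u * v * hc)

lemma modeMap_add (m : ℤ) (f g : ℝ → Fin 2 → ℝ) (p : ℝ × ℝ) :
    modeMap m (f + g) p = modeMap m f p + modeMap m g p := by
  simp only [modeMap, ← smul_add, ← mulVec_add]
  congr 3
  ext k
  simp

lemma modeMap_smul (m : ℤ) (a : ℝ) (f : ℝ → Fin 2 → ℝ) (p : ℝ × ℝ) :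
    modeMap m (a • f) p = a • modeMap m f p := by
  simp only [modeMap, smul_comm a, ← mulVec_smul]
  congr 3
  ext k
  simp

/-- The map `f ↦ N 𝒫_m f` from univariate vector functions to vector fields of mode `m`. -/
def modeField (m : ℤ) : (ℝ → Fin 2 → ℝ) →ₗ[ℝ] (ℝ × ℝ → Fin 2 → ℂ) where
  toFun f p := weightN p *ᵥ modeMap m f p
  map_add' f g := funext fun p => by simp only [modeMap_add, mulVec_add, Pi.add_apply]
  map_smul' a f := funext fun p => by
    simp only [modeMap_smul, mulVec_smul, Pi.smul_apply, RingHom.id_apply]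

lemma modeField_apply (m : ℤ) (f : ℝ → Fin 2 → ℝ) (p : ℝ × ℝ) :
    modeField m f p = weightN p *ᵥ modeMap m f p := rfl

lemma modeField_eq {m : ℤ} (hm : m ≠ 0) {f : ℝ → Fin 2 → ℝ} {A G : ℝ → ℝ}
    (hf : ∀ t, f t = ![A t + t * G t, A t]) :
    modeField m f
      = (fun p => (A (radius p ^ 2) : ℂ) • planarVar (modeUnit m) p ^ (m.natAbs - 1)
            • ![1, modeUnit m])
        + (fun p => (G (radius p ^ 2) : ℂ) • planarVar (modeUnit m) p ^ m.natAbs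
            • ![(p.1 : ℂ), (p.2 : ℂ)])
        - (modeUnit m) • fun p => (A (radius p ^ 2) : ℂ)
            • planarVar (modeUnit m) p ^ m.natAbs • ![-(p.2 : ℂ), (p.1 : ℂ)] := by
  have hc := modeUnit_sq hm
  funext p
  have hw := pow_sub_one_mul (Int.natAbs_ne_zero.2 hm) (planarVar (modeUnit m) p)
  rw [modeField_apply, modeMap_eq hm hf, weightN_mulVec]
  simp only [Pi.sub_apply, Pi.add_apply, Pi.smul_apply, smul_smul]
  congr 2
  simp only [cons_val_zero, cons_val_one, smul_eq_mul]
  rw [← hw, planarVar]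
  linear_combination (-(A (radius p ^ 2) : ℂ) * (p.1 + modeUnit m * p.2) ^ (m.natAbs - 1)
    * p.2) * hc

lemma hasCurl_modeField {m : ℤ} (hm : m ≠ 0) {f : ℝ → Fin 2 → ℝ} {A G : ℝ[X]}
    (hf : ∀ t, f t = ![(A + X * G).eval t, A.eval t]) :
    HasCurl (modeField m f) fun p =>
      ((2 * derivative ((1 - X) * A) - C (m.natAbs : ℝ) * (A + G)).eval (radius p ^ 2) : ℝ)
        * (modeUnit m * harmonicY m p) := by
  have hc := modeUnit_sq hm
  rw [modeField_eq hm (A := fun t => A.eval t) (G := fun t => G.eval t) fun t => by simp [hf t]]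
  have hconst := ((hasCurl_const ![1, modeUnit m]).planarVar_pow_smul
    (modeUnit m) (m.natAbs - 1)).radial_smul A.differentiable
  have hpos := (hasCurl_position.planarVar_pow_smul
    (modeUnit m) m.natAbs).radial_smul G.differentiable
  have hrot := (hasCurl_rotation.planarVar_pow_smul
    (modeUnit m) m.natAbs).radial_smul A.differentiable
  refine ((hconst.add hpos).sub (hrot.const_smul (modeUnit m))).congr_curl fun p => ?_
  have hw := pow_sub_one_mul (Int.natAbs_ne_zero.2 hm) (planarVar (modeUnit m) p)
  have heval (t : ℝ) : (2 * derivative ((1 - X) * A) - C (m.natAbs : ℝ) * (A + G)).eval t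
      = 2 * ((1 - t) * A.derivative.eval t - A.eval t) - m.natAbs * (A.eval t + G.eval t) := by
    simp only [derivative_mul, derivative_sub, derivative_one, derivative_X, eval_sub, eval_add,
      eval_mul, eval_C, eval_X, eval_one, eval_ofNat, eval_zero]
    ring
  have hr : (radius p : ℂ) ^ 2 = p.1 ^ 2 + p.2 ^ 2 := mod_cast radius_sq p
  rw [heval, harmonicY_eq_planarVar_pow, ← hw]
  generalize planarVar (modeUnit m) p ^ (m.natAbs - 1) = e
  simp only [Pi.ofNat_apply, Pi.smul_apply, cons_val_zero, cons_val_one,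
    smul_eq_mul, Polynomial.deriv, planarVar]
  push_cast
  rw [hr]
  linear_combination (e * p.2 * (m.natAbs * (G.eval (radius p ^ 2) : ℝ)
    - 2 * (A.derivative.eval (radius p ^ 2) : ℝ))) * hc

lemma hasCurl_modeField_vecV {m : ℤ} (hm : m ≠ 0) (n : ℕ) :
    HasCurl (modeField m (vecV n ((m.natAbs : ℝ) - 1))) 0 := by
  obtain ⟨b, hb⟩ : ∃ b : ℝ, (m.natAbs : ℝ) = b + 1 := ⟨m.natAbs - 1, by ring⟩
  have h := hasCurl_modeField hm (f := vecV n b) (A := C (b + 1) * shiftedJacobi n 1 (b + 1))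
    (G := -(C (b + 1) * shiftedJacobi n 1 (b + 1))
      - C (2 * (n + 1) : ℝ) * shiftedJacobi n 0 (b + 2))
    fun t => by
      simp only [vecV, eval_add, eval_sub, eval_neg, eval_mul, eval_C, eval_X, eval_shiftedJacobi]
      congr 1
      ring
  have hpoly : 2 * derivative ((1 - X) * (C (b + 1) * shiftedJacobi n 1 (b + 1)))
      - C (b + 1) * (C (b + 1) * shiftedJacobi n 1 (b + 1)
        + (-(C (b + 1) * shiftedJacobi n 1 (b + 1))
          - C (2 * (n + 1) : ℝ) * shiftedJacobi n 0 (b + 2))) = 0 := by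
    have hder := derivative_one_sub_X_mul_shiftedJacobi n (b + 1)
    rw [show b + 1 + 1 = b + 2 by ring] at hder
    rw [mul_left_comm (1 - X), derivative_C_mul, hder, map_mul, map_ofNat]
    ring
  rw [hb, hpoly] at h
  rw [hb, add_sub_cancel_right]
  exact h.congr_curl fun p => by simp

lemma hasCurl_modeField_jacobiP_smul {m : ℤ} (hm : m ≠ 0) (n : ℕ) :
    HasCurl
      (modeField m fun t =>
        (jacobiP n 1 ((m.natAbs : ℝ) - 1)).eval (2 * t - 1) • ![1 - t, 1])
      fun p => -(2 * (n + 1) * (modeUnit m * zernike m n p)) := by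
  have h := hasCurl_modeField hm
    (f := fun t => (jacobiP n 1 ((m.natAbs : ℝ) - 1)).eval (2 * t - 1) • ![1 - t, 1])
    (A := shiftedJacobi n 1 ((m.natAbs : ℝ) - 1)) (G := -shiftedJacobi n 1 ((m.natAbs : ℝ) - 1))
    fun t => by
      simp only [eval_add, eval_mul, eval_neg, eval_X, eval_shiftedJacobi, smul_cons, smul_eq_mul,
        smul_empty, mul_one]
      congr 1
      ring
  rw [derivative_one_sub_X_mul_shiftedJacobi, sub_add_cancel, add_neg_cancel, mul_zero,
    sub_zero] at h
  refine h.congr_curl fun p => ?_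
  simp only [eval_mul, eval_neg, eval_C, eval_ofNat, eval_shiftedJacobi, zernike, zernikeGen]
  push_cast
  ring

lemma n1_eq_modeField {m : ℤ} (hm : m ≠ 0) (j : ℕ) :
    n1 m j = modeField m (vecQ1 j ((m.natAbs : ℝ) - 1)) :=
  funext fun p => by rw [n1, vecN1, if_neg hm, modeField_apply]

lemma n2_eq_modeField {m : ℤ} (hm : m ≠ 0) (j : ℕ) :
    n2 m j = modeField m (vecQ2 j ((m.natAbs : ℝ) - 1)) :=
  funext fun p => by rw [n2, vecN2, if_neg hm, modeField_apply]

lemma hasCurl_n1 {m : ℤ} (hm : m ≠ 0) (j : ℕ) :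
    HasCurl (n1 m j) fun p =>
      -(2 * (2 * j + m.natAbs) * (2 * j + m.natAbs + 1) * (2 * j + m.natAbs + 2)
          / (frakR j ((m.natAbs : ℝ) - 1) : ℝ)) * (modeUnit m * zernike m j p) := by
  set b : ℝ := m.natAbs - 1 with hb
  have hbm : (m.natAbs : ℂ) = b + 1 := by rw [hb]; push_cast; ring
  have hQ : vecQ1 j b = ((2 * j + b + 1) / ((j + 1) * frakR j b)) •
      (((2 * j + b + 2) * (2 * j + b + 3))
          • (fun t => (jacobiP j 1 b).eval (2 * t - 1) • ![1 - t, 1])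
        - (j + b + 2) • vecV j b) := by
    funext t
    simp only [vecQ1, Pi.smul_apply, Pi.sub_apply, smul_smul]
  rw [n1_eq_modeField hm, hQ, map_smul, map_sub, map_smul, map_smul, ← Complex.coe_smul,
    ← Complex.coe_smul, ← Complex.coe_smul]
  refine ((((hasCurl_modeField_jacobiP_smul hm j).const_smul _).sub
    ((hasCurl_modeField_vecV hm j).const_smul _)).const_smul _).congr_curl fun p => ?_
  have hj : (j + 1 : ℂ) ≠ 0 := Nat.cast_add_one_ne_zero j
  rw [hbm, Pi.zero_apply]
  push_cast
  rw [mul_zero, sub_zero]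
  field_simp
  ring

lemma nPlus_succ_eq_modeField {m : ℤ} (hm : m ≠ 0) (n : ℕ) :
    nPlus m (n + 1)
      = ((-(1 / (n + 1)) : ℝ) : ℂ) • modeField m (vecV n ((m.natAbs : ℝ) - 1)) := by
  have hQ (b : ℝ) : vecQ1 (n + 1) b + vecQ2 (n + 1) b = (-(1 / (n + 1)) : ℝ) • vecV n b := by
    funext t
    simp only [vecQ2, Pi.add_apply, Pi.smul_apply]
    module
  have h : nPlus m (n + 1) = n1 m (n + 1) + n2 m (n + 1) := funext fun p => if_neg hm
  rw [h, n1_eq_modeField hm, n2_eq_modeField hm, ← map_add, hQ, map_smul, Complex.coe_smul]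

lemma weightN_mulVec_position (p : ℝ × ℝ) :
    weightN p *ᵥ ![(p.1 : ℂ), (p.2 : ℂ)] = ![(p.1 : ℂ), (p.2 : ℂ)] := by
  rw [weightN_mulVec]
  simp [mul_comm]

lemma weightN_mulVec_rotation (p : ℝ × ℝ) :
    weightN p *ᵥ ![-(p.2 : ℂ), (p.1 : ℂ)]
      = (1 - radius p ^ 2 : ℂ) • ![-(p.2 : ℂ), (p.1 : ℂ)] := by
  have hr : (radius p : ℂ) ^ 2 = p.1 ^ 2 + p.2 ^ 2 := mod_cast radius_sq p
  rw [weightN_mulVec, hr, cons_val_one, cons_val_zero, cons_val_zero]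
  module

lemma hasCurl_radial {φ : ℝ → ℝ} (hφ : Differentiable ℝ φ) :
    HasCurl (fun p => (φ (radius p ^ 2) : ℂ) • ![(p.1 : ℂ), (p.2 : ℂ)]) 0 :=
  (hasCurl_position.radial_smul hφ).congr_curl fun p => by
    simp [mul_comm (p.1 : ℂ)]

lemma hasCurl_azimuthal (φ : ℝ[X]) :
    HasCurl (fun p => ((φ.eval (radius p ^ 2) : ℝ) : ℂ) • ![-(p.2 : ℂ), (p.1 : ℂ)])
      fun p => 2 * ((derivative (X * φ)).eval (radius p ^ 2) : ℝ) := by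
  refine (hasCurl_rotation.radial_smul φ.differentiable).congr_curl fun p => ?_
  have hr : (radius p : ℂ) ^ 2 = p.1 ^ 2 + p.2 ^ 2 := mod_cast radius_sq p
  simp only [derivative_mul, derivative_X, eval_add, eval_mul, eval_X, one_mul, Polynomial.deriv,
    Pi.ofNat_apply, cons_val_zero, cons_val_one]
  push_cast
  rw [hr]
  ring

lemma hasCurl_nPlus (m : ℤ) {j : ℕ} (hj : 1 ≤ j) : HasCurl (nPlus m j) 0 := by
  rcases eq_or_ne m 0 with rfl | hm
  · have hn : n1 0 j = fun p => (((shiftedJacobi (j - 1) 0 1).eval (radius p ^ 2) : ℝ) : ℂ)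
        • ![(p.1 : ℂ), (p.2 : ℂ)] := funext fun p => by
      rw [n1, vecN1, if_pos rfl, mulVec_smul, weightN_mulVec_position, eval_shiftedJacobi]
    have h : nPlus 0 j = (2 : ℂ) • n1 0 j := funext fun p => if_pos rfl
    rw [h, hn]
    exact ((hasCurl_radial (shiftedJacobi (j - 1) 0 1).differentiable).const_smul 2).congr_curl
      fun _ => mul_zero 2
  · obtain ⟨n, rfl⟩ := Nat.exists_eq_add_of_le' hj
    rw [nPlus_succ_eq_modeField hm]
    exact ((hasCurl_modeField_vecV hm n).const_smul _).congr_curl fun _ => mul_zero _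

lemma hasCurl_nMinus_zero {j : ℕ} (hj : 1 ≤ j) :
    HasCurl (nMinus 0 j) fun p => -4 * j * zernike 0 j p := by
  obtain ⟨n, rfl⟩ := Nat.exists_eq_add_of_le' hj
  have hn : n2 0 (n + 1) = fun p =>
      ((((1 - X) * shiftedJacobi n 1 1).eval (radius p ^ 2) : ℝ) : ℂ)
      • ![-(p.2 : ℂ), (p.1 : ℂ)] := funext fun p => by
    rw [n2, vecN2, if_pos rfl, Nat.add_sub_cancel, mulVec_smul, weightN_mulVec_rotation,
      smul_smul, eval_mul, eval_shiftedJacobi]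
    simp [mul_comm]
  have h : nMinus 0 (n + 1) = (2 : ℂ) • n2 0 (n + 1) := funext fun p => if_pos rfl
  rw [h, hn]
  refine ((hasCurl_azimuthal _).const_smul 2).congr_curl fun p => ?_
  rw [derivative_X_mul_one_sub_X_mul_shiftedJacobi, eval_neg, eval_mul, eval_C,
    eval_shiftedJacobi, zernike, zernikeGen, harmonicY, Int.natAbs_zero, pow_zero]
  push_cast
  ring

lemma nMinus_eq_sub_nPlus {m : ℤ} (hm : m ≠ 0) {j : ℕ} (hj : j ≠ 0) :
    nMinus m j = (2 : ℂ) • n1 m j - nPlus m j := by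
  funext p
  rw [nMinus, if_neg hm, if_neg hj, Pi.sub_apply, Pi.smul_apply, nPlus, if_neg hm]
  module

lemma hasCurl_nMinus {m : ℤ} (hm : m ≠ 0) (j : ℕ) :
    HasCurl (nMinus m j) fun p =>
      -(4 * (2 * j + m.natAbs) * (2 * j + m.natAbs + 1) * (2 * j + m.natAbs + 2)
          / (frakR j ((m.natAbs : ℝ) - 1) : ℝ)) * Complex.I * m.sign * zernike m j p := by
  have h := (hasCurl_n1 hm j).const_smul 2
  rcases eq_or_ne j 0 with rfl | hj
  · have hn : nMinus m 0 = (2 : ℂ) • n1 m 0 :=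
      funext fun p => (if_neg hm).trans (if_pos rfl)
    rw [hn]
    exact h.congr_curl fun p => by rw [modeUnit]; ring
  · rw [nMinus_eq_sub_nPlus hm hj]
    exact (h.sub (hasCurl_nPlus m (Nat.one_le_iff_ne_zero.2 hj))).congr_curl fun p => by
      rw [modeUnit, Pi.zero_apply]; ring

end DiskVectorOP

end

theorem theorem7 :
    (∀ (m : ℤ) (j : ℕ), 1 ≤ j →
      Differentiable ℝ (DiskVectorOP.nPlus m j) ∧
        ∀ p : ℝ × ℝ, DiskVectorOP.curl (DiskVectorOP.nPlus m j) p = 0) ∧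
    (∀ j : ℕ, 1 ≤ j →
      Differentiable ℝ (DiskVectorOP.nMinus 0 j) ∧
        ∀ p : ℝ × ℝ, DiskVectorOP.curl (DiskVectorOP.nMinus 0 j) p
          = -4 * (j : ℂ) * DiskVectorOP.zernike 0 j p) ∧
    (∀ (m : ℤ) (j : ℕ), m ≠ 0 →
      Differentiable ℝ (DiskVectorOP.nMinus m j) ∧
        ∀ p : ℝ × ℝ, DiskVectorOP.curl (DiskVectorOP.nMinus m j) p
          = -(4 * (2 * (j : ℂ) + (m.natAbs : ℂ)) * (2 * (j : ℂ) + (m.natAbs : ℂ) + 1)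
                * (2 * (j : ℂ) + (m.natAbs : ℂ) + 2)
              / ((DiskVectorOP.frakR j ((m.natAbs : ℝ) - 1) : ℝ) : ℂ))
            * Complex.I * (m.sign : ℂ) * DiskVectorOP.zernike m j p) :=
  ⟨fun m _ hj => DiskVectorOP.hasCurl_nPlus m hj, fun _ hj => DiskVectorOP.hasCurl_nMinus_zero hj,
    fun _ j hm => DiskVectorOP.hasCurl_nMinus hm j⟩
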